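/- Let $\mathcal A,\mathcal B,\mathcal X,\mathcal Y$ be finite sets. A two-player game is a pair $(q,H)$ with $q$ a probability distribution on $\mathcal A\times\mathcal B$ and $H\colon\mathcal A\times\mathcal B\times\mathcal X\times\mathcal Y\to[0,1]$; it has complete support if $q(a,b)\neq 0$ for all $a\in\mathcal A$, $b\in\mathcal B$. A (quantum) strategy $\Gamma=(D,E,\{\{R_a^x\}_x\}_a,\{\{S_b^y\}_y\}_b,\gamma)$ consists of finite-dimensional complex Hilbert spaces $D,E$, for every $a\in\mathcal A$ a POVM $\{R_a^x\}_{x\in\mathcal X}$ on $D$, for every $b\in\mathcal B$ a POVM $\{S_b^y\}_{y\in\mathcal Y}$ on $E$, and a density operator $\gamma$ on $D\otimes E$. The correlation it achieves is the family $p_{ab}^{xy}=\operatorname{Tr}[\gamma(R_a^x\otimes S_b^y)]$, which is non-negative, satisfies $\sum_{x,y}p_{ab}^{xy}=1$ for all $a,b$, and is non-signaling ($\sum_y p_{ab}^{xy}$ does not depend on $b$, and $\sum_x p_{ab}^{xy}$ does not depend on $a$). The strategy allows perfect guessing (by Bob) if for all $a,b,y$ and all $x\neq x'$ the operators $\rho_{ab}^{xy}$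 and $\rho_{ab}^{x'y}$ have orthogonal supports, where $$\rho_{ab}^{xy}=\operatorname{Tr}_D\!\left[\sqrt{R_a^x\otimes S_b^y}\;\gamma\;\sqrt{R_a^x\otimes S_b^y}\right].$$ Corollary. If a strategy for a complete-support game allows perfect guessing, then the correlation $(p_{ab}^{xy})$ it achieves is classical, i.e. it is a convex combination of product distributions $q_a^x\,r_b^y$, where $q_a^x,r_b^y\ge 0$, $\sum_x q_a^x=1$ for all $a$ and $\sum_y r_b^y=1$ for all $b$. -/

import Mathlib

open scoped TensorProduct

namespace NonlocalGame

/-! ### Operators on finite-dimensional Hilbert spaces -/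

section Operators

variable {V : Type*} [NormedAddCommGroup V] [InnerProductSpace ℂ V] [FiniteDimensional ℂ V]

/-- The positive square root of a positive operator on a finite-dimensional Hilbert space,
given by the continuous functional calculus. -/
noncomputable def opSqrt (T : V →ₗ[ℂ] V) : V →ₗ[ℂ] V :=
  letI : CompleteSpace V := FiniteDimensional.complete ℂ V
  ((CFC.sqrt (LinearMap.toContinuousLinearMap T) : V →L[ℂ] V) : V →ₗ[ℂ] V)

/-- The support of a Hermitian operator: the orthogonal complement of its kernel. -/
noncomputable def support (T : V →ₗ[ℂ] V) : Submodule ℂ V := (LinearMap.ker T)ᗮ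

/-- A family of positive operators is perfectly distinguishable if any two of its members have
orthogonal supports. -/
def PerfectlyDistinguishable {ι : Type*} (χ : ι → V →ₗ[ℂ] V) : Prop :=
  ∀ i j, i ≠ j → support (χ i) ⟂ support (χ j)

/-- A positive operator valued measure on `V` with outcomes in the finite set `X`. -/
def IsPOVM {X : Type*} [Fintype X] (R : X → V →ₗ[ℂ] V) : Prop :=
  (∀ x, (R x).IsPositive) ∧ ∑ x, R x = LinearMap.id

/-- A density operator: positive with trace one. -/
def IsDensity (T : V →ₗ[ℂ] V) : Prop :=
  T.IsPositive ∧ LinearMap.trace ℂ V T = 1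

end Operators

section PartialTrace

variable (D E : Type*) [NormedAddCommGroup D] [InnerProductSpace ℂ D] [FiniteDimensional ℂ D]
  [NormedAddCommGroup E] [InnerProductSpace ℂ E] [FiniteDimensional ℂ E]

/-- The partial trace over the first factor: the linear map `L(D ⊗ E) → L(E)` sending
`M ⊗ N` to `Tr(M) N`. -/
noncomputable def partialTrace : (D ⊗[ℂ] E →ₗ[ℂ] D ⊗[ℂ] E) →ₗ[ℂ] (E →ₗ[ℂ] E) :=
  (TensorProduct.lid ℂ (E →ₗ[ℂ] E)).toLinearMap ∘ₗ
    LinearMap.rTensor (E →ₗ[ℂ] E) (LinearMap.trace ℂ D) ∘ₗ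
    (homTensorHomEquiv ℂ D E D E).symm.toLinearMap

end PartialTrace

/-! ### Correlations and games -/

section Correlations

variable (A B X Y : Type*) [Fintype A] [Fintype B] [Fintype X] [Fintype Y]

/-- A two-player input-output correlation: `prob a b x y` is the probability of the outputs
`x, y` on the inputs `a, b`; the marginals are non-signaling. -/
structure Correlation where
  prob : A → B → X → Y → ℝ
  nonneg : ∀ a b x y, 0 ≤ prob a b x y
  sum_eq_one : ∀ a b, ∑ x, ∑ y, prob a b x y = 1
  noSignal_left : ∀ a x b b', ∑ y, prob a b x y = ∑ y, prob a b' x y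
  noSignal_right : ∀ b y a a', ∑ x, prob a b x y = ∑ x, prob a' b x y

/-- The product distributions `(q_a^x) ⊗ (r_b^y)`. -/
def productDistributions : Set (A → B → X → Y → ℝ) :=
  {p | ∃ (q : A → X → ℝ) (r : B → Y → ℝ),
    (∀ a x, 0 ≤ q a x) ∧ (∀ a, ∑ x, q a x = 1) ∧
    (∀ b y, 0 ≤ r b y) ∧ (∀ b, ∑ y, r b y = 1) ∧
    ∀ a b x y, p a b x y = q a x * r b y}

variable {A B X Y} in
/-- A correlation is classical if it is a convex combination of product distributions. -/
def Correlation.IsClassical (p : Correlation A B X Y) : Prop :=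
  p.prob ∈ convexHull ℝ (productDistributions A B X Y)

/-- A two-player game: a probability distribution `q` on input pairs and a scoring function `H`
with values in `[0, 1]`. -/
structure Game where
  q : A → B → ℝ
  q_nonneg : ∀ a b, 0 ≤ q a b
  q_sum : ∑ a, ∑ b, q a b = 1
  H : A → B → X → Y → ℝ
  H_mem : ∀ a b x y, H a b x y ∈ Set.Icc (0 : ℝ) 1

variable {A B X Y} in
/-- Every pair of inputs occurs with nonzero probability. -/
def Game.CompleteSupport (G : Game A B X Y) : Prop := ∀ a b, G.q a b ≠ 0

end Correlations

/-! ### Quantum strategies -/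

section Strategies

/-- A two-player quantum strategy on the Hilbert spaces `D` (Alice) and `E` (Bob). -/
structure Strategy (A B X Y : Type*) [Fintype X] [Fintype Y]
    (D E : Type*) [NormedAddCommGroup D] [InnerProductSpace ℂ D] [FiniteDimensional ℂ D]
    [NormedAddCommGroup E] [InnerProductSpace ℂ E] [FiniteDimensional ℂ E] where
  R : A → X → D →ₗ[ℂ] D
  S : B → Y → E →ₗ[ℂ] E
  γ : D ⊗[ℂ] E →ₗ[ℂ] D ⊗[ℂ] E
  R_povm : ∀ a, IsPOVM (R a)
  S_povm : ∀ b, IsPOVM (S b)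
  γ_density : IsDensity γ

variable {A B X Y : Type*} [Fintype X] [Fintype Y]
  {D E : Type*} [NormedAddCommGroup D] [InnerProductSpace ℂ D] [FiniteDimensional ℂ D]
  [NormedAddCommGroup E] [InnerProductSpace ℂ E] [FiniteDimensional ℂ E]

/-- The (subnormalized) second-player state
`ρ_{ab}^{xy} = Tr_D [√(R_a^x ⊗ S_b^y) γ √(R_a^x ⊗ S_b^y)]`. -/
noncomputable def Strategy.bobState (Γ : Strategy A B X Y D E) (a : A) (b : B) (x : X) (y : Y) :
    E →ₗ[ℂ] E :=
  partialTrace D E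
    (opSqrt (TensorProduct.map (Γ.R a x) (Γ.S b y)) ∘ₗ Γ.γ ∘ₗ
      opSqrt (TensorProduct.map (Γ.R a x) (Γ.S b y)))

/-- After the game, the states of Bob that belong to the different outputs `x` of Alice are
perfectly distinguishable, for all inputs `a, b` and every output `y` of Bob. -/
def Strategy.AllowsPerfectGuessing (Γ : Strategy A B X Y D E) : Prop :=
  ∀ a b y, PerfectlyDistinguishable fun x => Γ.bobState a b x y

/-- The strategy achieves the correlation `p`: `p_{ab}^{xy} = Tr [γ (R_a^x ⊗ S_b^y)]`. -/
def Strategy.Achieves [Fintype A] [Fintype B] (Γ : Strategy A B X Y D E)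
    (p : Correlation A B X Y) : Prop :=
  ∀ a b x y, (p.prob a b x y : ℂ) =
    LinearMap.trace ℂ (D ⊗[ℂ] E) (Γ.γ ∘ₗ TensorProduct.map (Γ.R a x) (Γ.S b y))

end Strategies

end NonlocalGame

/-!
Alice's measurement `R_a` steers Bob's system into the unnormalized states
`σ_a^x = Tr_D[γ (R_a^x ⊗ 1)]`, whose sum over `x` is the reduced state `s = Tr_D γ` for every `a`,
and `p_{ab}^{xy} = Tr[σ_a^x S_b^y]`. Perfect guessing says that the operators
`√S_b^y σ_a^x √S_b^y` have orthogonal supports for different `x`, which amounts to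
`σ_a^x S_b^y σ_a^{x'} = 0` (`mul_mul_eq_zero_of_support`). Summing over `y` gives
`σ_a^x σ_a^{x'} = 0`.

So, for each `a`, the projections `P_a^x` onto the supports of the `σ_a^x` are orthogonal, add up to
the projection `Q` onto the support of `s`, satisfy `P_a^x s = σ_a^x`, and commute with `s`
(`exists_supportProjections`). Since also `P_a^x S_b^y P_a^{x'} = 0`, they commute with the positive
operators `K_b^y = √s S_b^y √s`, and `p_{ab}^{xy} = Tr[P_a^x K_b^y]`. In other words, Bob's part
of the state predicts Alice's output for any single `a` without disturbing Bob's own statistics.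

The projections for different `a` need not commute with each other, but they can be measured one
after the other, in any order. This yields positive operators `M_l`, indexed by functions
`l : A → X`. As every `P_a^x` commutes with `K_b^y`, neither the earlier nor the later measurements
affect the joint statistics of one of them with `K_b^y`, so the marginals of `Tr[M_l K_b^y]` are the
`p_{ab}^{xy}` (`exists_sequential_measurement`). Moreover `∑_y Tr[M_l K_b^y] = Tr[M_l s]` does not
depend on `b`, so `l` serves as a hidden variable that determines Alice's answers and leaves Bob to
sample `y` conditionally on `l` (`Correlation.isClassical_of_deterministic`).
-/

open scoped ComplexOrder

namespace NonlocalGame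

/-! ### Square roots, pseudo-inverses and supports of positive operators -/

section

variable {V : Type*} [NormedAddCommGroup V] [InnerProductSpace ℂ V] [FiniteDimensional ℂ V]

lemma opSqrt_isPositive (T : V →ₗ[ℂ] V) : (opSqrt T).IsPositive := by
  let : CompleteSpace V := FiniteDimensional.complete ℂ V
  exact (ContinuousLinearMap.isPositive_toLinearMap_iff _).mpr
    ((ContinuousLinearMap.nonneg_iff_isPositive _).mp (CFC.sqrt_nonneg _))

lemma opSqrt_mul_self {T : V →ₗ[ℂ] V} (hT : T.IsPositive) : opSqrt T * opSqrt T = T := by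
  let : CompleteSpace V := FiniteDimensional.complete ℂ V
  have h := CFC.sqrt_mul_sqrt_self (LinearMap.toContinuousLinearMap T)
    ((ContinuousLinearMap.nonneg_iff_isPositive _).mpr hT)
  ext v
  exact congr($h v)

lemma opSqrt_unique {S T : V →ₗ[ℂ] V} (hS : S.IsPositive) (h : S * S = T) : opSqrt T = S := by
  let : CompleteSpace V := FiniteDimensional.complete ℂ V
  have h' : CFC.sqrt (LinearMap.toContinuousLinearMap T) = LinearMap.toContinuousLinearMap S :=
    CFC.sqrt_unique (by ext v; exact congr($h v))
      ((ContinuousLinearMap.nonneg_iff_isPositive _).mpr hS)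
  ext v
  exact congr($h' v)

lemma commute_opSqrt {T Z : V →ₗ[ℂ] V} (h : Commute T Z) : Commute (opSqrt T) Z := by
  let : CompleteSpace V := FiniteDimensional.complete ℂ V
  have h' : Commute (LinearMap.toContinuousLinearMap T) (LinearMap.toContinuousLinearMap Z) := by
    ext v; exact congr($h.eq v)
  have h2 := h'.cfcₙ_nnreal NNReal.sqrt
  ext v
  exact congr($h2.eq v)

/-- The Moore-Penrose pseudo-inverse of a positive operator, as an element of its bicommutant.
It is the continuous functional calculus of `t ↦ t⁻¹`. -/
lemma exists_pseudoInverse {T : V →ₗ[ℂ] V} (hT : T.IsPositive) :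
    ∃ J : V →ₗ[ℂ] V, IsSelfAdjoint J ∧ T * J * T = T ∧ J * T * J = J ∧
      ∀ Z, Commute T Z → Commute J Z := by
  let : CompleteSpace V := FiniteDimensional.complete ℂ V
  set T' := LinearMap.toContinuousLinearMap T with hT'
  have hsa : IsSelfAdjoint T' := (ContinuousLinearMap.IsPositive.isSelfAdjoint
    (T.isPositive_toContinuousLinearMap_iff.mpr hT))
  have hfin : (spectrum ℝ T').Finite := by
    have h1 : (spectrum ℂ T').Finite := by
      have := Module.End.finite_spectrum T
      rwa [← AlgEquiv.spectrum_eq (Module.End.toContinuousLinearMap V) T] at this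
    rw [← spectrum.preimage_algebraMap (R := ℝ) ℂ]
    exact h1.preimage (FaithfulSMul.algebraMap_injective ℝ ℂ).injOn
  -- On a finite spectrum every function is continuous, in particular `t ↦ t⁻¹` with `0⁻¹ = 0`.
  have hc : ∀ f : ℝ → ℝ, ContinuousOn f (spectrum ℝ T') := fun f => hfin.continuousOn f
  have e1 : T' * cfc (fun t : ℝ => t⁻¹) T' * T' = T' := by
    conv_rhs => rw [← cfc_id' ℝ T']
    conv_lhs => enter [2]; rw [← cfc_id' ℝ T']
    conv_lhs => enter [1, 1]; rw [← cfc_id' ℝ T']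
    rw [← cfc_mul _ _ _ (hc _) (hc _), ← cfc_mul _ _ _ (hc _) (hc _)]
    simp
  have e2 : cfc (fun t : ℝ => t⁻¹) T' * T' * cfc (fun t : ℝ => t⁻¹) T'
      = cfc (fun t : ℝ => t⁻¹) T' := by
    conv_lhs => enter [1, 2]; rw [← cfc_id' ℝ T']
    rw [← cfc_mul _ _ _ (hc _) (hc _), ← cfc_mul _ _ _ (hc _) (hc _)]
    congr 1
    ext t
    by_cases ht : t = 0 <;> simp [ht]
  refine ⟨((cfc (fun t : ℝ => t⁻¹) T' : V →L[ℂ] V) : V →ₗ[ℂ] V), ?_, ?_, ?_, ?_⟩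
  · rw [← LinearMap.isSymmetric_iff_isSelfAdjoint]
    exact ContinuousLinearMap.isSelfAdjoint_iff_isSymmetric.mp (cfc_predicate _ T')
  · ext v; exact congr($e1 v)
  · ext v; exact congr($e2 v)
  · intro Z hZ
    have h' : Commute T' (LinearMap.toContinuousLinearMap Z) := by
      ext v; exact congr($hZ.eq v)
    have h2 := hsa.commute_cfc h' (fun t : ℝ => t⁻¹)
    ext v
    exact congr($h2.eq v)

lemma mul_eq_zero_of_star_mul_self_mul {K Z : V →ₗ[ℂ] V} (h : star K * K * Z = 0) :
    K * Z = 0 := by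
  ext v
  have : inner ℂ (K (Z v)) (K (Z v)) = (0 : ℂ) := by
    rw [← LinearMap.adjoint_inner_left]
    have := congr($h v)
    simp only [Module.End.mul_apply, LinearMap.star_eq_adjoint] at this
    simp [this]
  simpa using this

lemma mul_eq_zero_of_support {S T : V →ₗ[ℂ] V} (hT : IsSelfAdjoint T)
    (h : support S ⟂ support T) : S * T = 0 := by
  ext v
  have h1 : T v ∈ support T := by
    rw [support, Submodule.mem_orthogonal]
    intro u hu
    rw [← LinearMap.adjoint_inner_left, ← LinearMap.star_eq_adjoint, hT.star_eq, hu]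
    simp
  have h2 : T v ∈ (support S)ᗮ := h.symm h1
  rw [support, Submodule.orthogonal_orthogonal] at h2
  simpa using h2

lemma isPositive_conj {T : V →ₗ[ℂ] V} (hT : T.IsPositive) (S : V →ₗ[ℂ] V) :
    (star S * T * S).IsPositive :=
  hT.adjoint_conj S

lemma isPositive_conj_self {S T : V →ₗ[ℂ] V} (hT : T.IsPositive) (hS : IsSelfAdjoint S) :
    (S * T * S).IsPositive := by
  simpa [hS.star_eq] using isPositive_conj hT S

lemma trace_mul_nonneg {S T : V →ₗ[ℂ] V} (hS : S.IsPositive) (hT : T.IsPositive) :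
    0 ≤ LinearMap.trace ℂ V (S * T) := by
  rw [← opSqrt_mul_self hS, mul_assoc, LinearMap.trace_mul_comm]
  exact (isPositive_conj_self hT (opSqrt_isPositive S).isSelfAdjoint).trace_nonneg

/-- If the conjugates of `σ` and `τ` by `√S` are orthogonal, then `σ S τ = 0`. With `k = √σ √S` and
`l = √τ √S` the hypothesis reads `k⋆ k l⋆ l = 0`, and cancelling the outer factors `k⋆` and `l`
leaves `k l⋆ = √σ S √τ = 0`. -/
lemma mul_mul_eq_zero_of_support {S σ τ : V →ₗ[ℂ] V} (hS : S.IsPositive)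
    (hσ : σ.IsPositive) (hτ : τ.IsPositive)
    (h : support (opSqrt S * σ * opSqrt S) ⟂ support (opSqrt S * τ * opSqrt S)) :
    σ * S * τ = 0 := by
  have hs := (opSqrt_isPositive S).isSelfAdjoint
  have hz := mul_eq_zero_of_support
    (isPositive_conj_self hτ hs).isSelfAdjoint h
  have h1 := (opSqrt_isPositive σ).isSelfAdjoint
  have h2 := (opSqrt_isPositive τ).isSelfAdjoint
  have e1 : (opSqrt σ * opSqrt S) * (opSqrt S * τ * opSqrt S) = 0 := by
    apply mul_eq_zero_of_star_mul_self_mul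
    rw [← hz]
    conv_rhs => rw [← opSqrt_mul_self hσ]
    simp only [star_mul, hs.star_eq, h1.star_eq, mul_assoc]
  have e2 : (opSqrt τ * opSqrt S) * (opSqrt S * opSqrt σ) = 0 := by
    apply mul_eq_zero_of_star_mul_self_mul
    have := congr(star $e1)
    simp only [star_mul, hs.star_eq, h1.star_eq, hτ.isSelfAdjoint.star_eq, star_zero] at this
    rw [← this]
    conv_rhs => rw [← opSqrt_mul_self hτ]
    simp only [star_mul, hs.star_eq, h2.star_eq, mul_assoc]
  have e3 : opSqrt σ * S * opSqrt τ = 0 := by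
    have := congr(star $e2)
    simp only [star_mul, hs.star_eq, h1.star_eq, h2.star_eq, star_zero] at this
    rw [← this]
    conv_lhs => rw [← opSqrt_mul_self hS]
    simp only [mul_assoc]
  calc σ * S * τ = opSqrt σ * (opSqrt σ * S * opSqrt τ) * opSqrt τ := by
        conv_lhs => rw [← opSqrt_mul_self hσ, ← opSqrt_mul_self hτ]
        simp only [mul_assoc]
    _ = 0 := by rw [e3]; simp

end

/-! ### The partial trace -/

section
open TensorProduct (map)
variable {D E : Type*} [NormedAddCommGroup D] [InnerProductSpace ℂ D] [FiniteDimensional ℂ D]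
  [NormedAddCommGroup E] [InnerProductSpace ℂ E] [FiniteDimensional ℂ E]

lemma end_tensor_induction {p : (D ⊗[ℂ] E →ₗ[ℂ] D ⊗[ℂ] E) → Prop}
    (h_map : ∀ M N, p (map M N)) (h_add : ∀ S T, p S → p T → p (S + T))
    (T : D ⊗[ℂ] E →ₗ[ℂ] D ⊗[ℂ] E) : p T := by
  obtain ⟨t, rfl⟩ := (homTensorHomEquiv ℂ D E D E).surjective T
  induction t with
  | zero => simpa using h_map 0 0
  | tmul M N => simpa [homTensorHomEquiv_apply] using h_map M N
  | add s t hs ht => simpa using h_add _ _ hs ht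

lemma partialTrace_map (M : D →ₗ[ℂ] D) (N : E →ₗ[ℂ] E) :
    partialTrace D E (map M N) = LinearMap.trace ℂ D M • N := by
  have h : (homTensorHomEquiv ℂ D E D E).symm (map M N) = M ⊗ₜ N := by
    rw [LinearEquiv.symm_apply_eq, homTensorHomEquiv_apply, TensorProduct.homTensorHomMap_apply]
  simp [partialTrace, h]

lemma partialTrace_map_mul_mul_map (A A' : D →ₗ[ℂ] D) (B B' : E →ₗ[ℂ] E)
    (T : D ⊗[ℂ] E →ₗ[ℂ] D ⊗[ℂ] E) :
    partialTrace D E (map A B * T * map A' B') =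
      B * partialTrace D E (map A 1 * T * map A' 1) * B' := by
  induction T using end_tensor_induction with
  | h_map M N => simp [← TensorProduct.map_mul, partialTrace_map]
  | h_add S T hS hT => simp only [mul_add, add_mul, map_add, hS, hT]

/-- The partial trace over `D` is cyclic with respect to operators acting on `D` only. -/
lemma partialTrace_map_one_mul_comm (A : D →ₗ[ℂ] D) (T : D ⊗[ℂ] E →ₗ[ℂ] D ⊗[ℂ] E) :
    partialTrace D E (map A 1 * T) = partialTrace D E (T * map A 1) := by
  induction T using end_tensor_induction with
  | h_map M N => simp [← TensorProduct.map_mul, partialTrace_map, LinearMap.trace_mul_comm ℂ A M]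
  | h_add S T hS hT => simp only [mul_add, add_mul, map_add, hS, hT]

lemma trace_partialTrace_mul (N : E →ₗ[ℂ] E) (T : D ⊗[ℂ] E →ₗ[ℂ] D ⊗[ℂ] E) :
    LinearMap.trace ℂ E (partialTrace D E T * N) =
      LinearMap.trace ℂ (D ⊗[ℂ] E) (T * map 1 N) := by
  induction T using end_tensor_induction with
  | h_map M N => simp [← TensorProduct.map_mul, partialTrace_map, LinearMap.trace_tensorProduct']
  | h_add S T hS hT => simp only [add_mul, map_add, hS, hT]

lemma inner_partialTrace {ι : Type*} [Fintype ι] (e : OrthonormalBasis ι ℂ D)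
    (T : D ⊗[ℂ] E →ₗ[ℂ] D ⊗[ℂ] E) (u v : E) :
    inner ℂ u (partialTrace D E T v) = ∑ i, inner ℂ (e i ⊗ₜ[ℂ] u) (T (e i ⊗ₜ v)) := by
  induction T using end_tensor_induction with
  | h_map M N =>
    simp [partialTrace_map, LinearMap.trace_eq_sum_inner M e, Finset.sum_mul]
  | h_add S T hS hT => simp [inner_add_right, hS, hT, Finset.sum_add_distrib]

lemma partialTrace_isPositive {T : D ⊗[ℂ] E →ₗ[ℂ] D ⊗[ℂ] E} (hT : T.IsPositive) :
    (partialTrace D E T).IsPositive := by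
  have e := stdOrthonormalBasis ℂ D
  have hsymm : (partialTrace D E T).IsSymmetric := fun u v => by
    rw [← inner_conj_symm, inner_partialTrace e, inner_partialTrace e, map_sum]
    exact Finset.sum_congr rfl fun i _ => (inner_conj_symm _ _).trans (hT.isSymmetric _ _)
  refine (LinearMap.isPositive_iff _).mpr ⟨hsymm, fun v => ?_⟩
  rw [hsymm, inner_partialTrace e]
  exact Finset.sum_nonneg fun i _ => hT.inner_nonneg_right _

lemma opSqrt_map {R : D →ₗ[ℂ] D} {S : E →ₗ[ℂ] E} (hR : R.IsPositive) (hS : S.IsPositive) :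
    opSqrt (map R S) = map (opSqrt R) (opSqrt S) := by
  refine opSqrt_unique ?_ ?_
  · have hr := opSqrt_isPositive R
    have hs := opSqrt_isPositive S
    have := LinearMap.isPositive_adjoint_comp_self
      (map (opSqrt (opSqrt R)) (opSqrt (opSqrt S)))
    rwa [TensorProduct.adjoint_map, (opSqrt_isPositive _).adjoint_eq,
      (opSqrt_isPositive _).adjoint_eq, ← Module.End.mul_eq_comp, ← TensorProduct.map_mul,
      opSqrt_mul_self hr, opSqrt_mul_self hs] at this
  · rw [← TensorProduct.map_mul, opSqrt_mul_self hR, opSqrt_mul_self hS]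

lemma map_isPositive {R : D →ₗ[ℂ] D} {S : E →ₗ[ℂ] E} (hR : R.IsPositive) (hS : S.IsPositive) :
    (map R S).IsPositive := by
  have := LinearMap.isPositive_adjoint_comp_self (map (opSqrt R) (opSqrt S))
  rwa [TensorProduct.adjoint_map, (opSqrt_isPositive _).adjoint_eq,
    (opSqrt_isPositive _).adjoint_eq, ← Module.End.mul_eq_comp, ← TensorProduct.map_mul,
    opSqrt_mul_self hR, opSqrt_mul_self hS] at this

end

/-! ### Measuring projections one after the other -/

section
variable {V : Type*} [NormedAddCommGroup V] [InnerProductSpace ℂ V] [FiniteDimensional ℂ V]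
variable {X : Type*} [Fintype X]

open Classical in
/-- Measuring the projections `P i` for `i = 0, …, n - 1` in turn gives positive operators `M l`,
nested products of projections. If `K` is supported on `Q` and commutes with all projections, then
the statistics of `M` in the state `K` have the statistics of each `P i` as their marginals. -/
theorem exists_sequential_measurement_fin (n : ℕ) (P : Fin n → X → V →ₗ[ℂ] V) (Q : V →ₗ[ℂ] V)
    (hQ : Q.IsPositive) (hsa : ∀ i x, IsSelfAdjoint (P i x))
    (hidem : ∀ i x, P i x * P i x = P i x) (hsum : ∀ i, ∑ x, P i x = Q)
    (hQP : ∀ i x, Q * P i x = P i x) :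
    ∃ M : (Fin n → X) → V →ₗ[ℂ] V, (∀ l, (M l).IsPositive) ∧ ∑ l, M l = Q ∧
      ∀ K, Q * K = K → (∀ i x, Commute (P i x) K) → ∀ i x,
        (∑ l, if l i = x then LinearMap.trace ℂ V (M l * K) else 0) =
          LinearMap.trace ℂ V (P i x * K) := by
  induction n with
  | zero => exact ⟨fun _ => Q, fun _ => hQ, by simp, fun _ _ _ i => i.elim0⟩
  | succ n ih =>
    have htail : ∀ x l, Fin.tail (Fin.consEquiv (fun _ : Fin (n + 1) => X) (x, l)) = l :=
      fun x l => Fin.tail_cons (α := fun _ => X) x l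
    obtain ⟨M, hM, hMQ, hMK⟩ := ih (fun i => P i.succ) (fun _ => hsa _) (fun _ => hidem _)
      (fun _ => hsum _) (fun _ => hQP _)
    refine ⟨fun l => P 0 (l 0) * M (Fin.tail l) * P 0 (l 0),
      fun l => isPositive_conj_self (hM _) (hsa _ _), ?_, ?_⟩
    · rw [← (Fin.consEquiv fun _ => X).sum_comp, Fintype.sum_prod_type]
      simp only [htail, Fin.consEquiv_apply, Fin.cons_zero, ← Finset.mul_sum,
        ← Finset.sum_mul, hMQ]
      rw [← hsum 0]
      refine Finset.sum_congr rfl fun x _ => ?_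
      rw [hsum, mul_assoc, hQP, hidem]
    · intro K hK hPK i x
      have key : ∀ (N : V →ₗ[ℂ] V) z, LinearMap.trace ℂ V (P 0 z * N * P 0 z * K) =
          LinearMap.trace ℂ V (N * (P 0 z * K)) := fun N z => by
        rw [mul_assoc, mul_assoc, LinearMap.trace_mul_comm, mul_assoc, mul_assoc, ← (hPK 0 z).eq,
          ← mul_assoc (P 0 z) (P 0 z) K, hidem]
      rw [← (Fin.consEquiv fun _ => X).sum_comp, Fintype.sum_prod_type]
      simp only [key, htail, Fin.consEquiv_apply, Fin.cons_zero]
      refine Fin.cases ?_ (fun j => ?_) i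
      -- The operators `M` of the other measurements add up to `Q`, which fixes `P 0 x * K`.
      · simp only [Fin.cons_zero]
        rw [Finset.sum_eq_single x (fun z _ hz => by simp [hz]) (by simp)]
        simp only [if_true]
        rw [← map_sum, ← Finset.sum_mul, hMQ, ← mul_assoc, hQP]
      -- Summing the outermost projection over its outcomes gives `Q`, which fixes `K`.
      · simp only [Fin.cons_succ]
        rw [Finset.sum_comm, ← hMK K hK (fun i x => hPK _ _) j x]
        refine Finset.sum_congr rfl fun l _ => ?_
        split_ifs
        · rw [← map_sum, ← Finset.mul_sum, ← Finset.sum_mul, hsum, hK]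
        · simp

open Classical in
/-- `exists_sequential_measurement_fin` for an arbitrary finite set of measurements, in an arbitrary
order. -/
theorem exists_sequential_measurement {A : Type*} [Fintype A] (P : A → X → V →ₗ[ℂ] V)
    (Q : V →ₗ[ℂ] V) (hQ : Q.IsPositive) (hsa : ∀ i x, IsSelfAdjoint (P i x))
    (hidem : ∀ i x, P i x * P i x = P i x) (hsum : ∀ i, ∑ x, P i x = Q)
    (hQP : ∀ i x, Q * P i x = P i x) :
    ∃ M : (A → X) → V →ₗ[ℂ] V, (∀ l, (M l).IsPositive) ∧
      ∀ K, Q * K = K → (∀ i x, Commute (P i x) K) → ∀ i x,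
        (∑ l, if l i = x then LinearMap.trace ℂ V (M l * K) else 0) =
          LinearMap.trace ℂ V (P i x * K) := by
  let e := Fintype.equivFin A
  obtain ⟨M, hM, -, hMK⟩ := exists_sequential_measurement_fin _ (fun i => P (e.symm i)) Q hQ
    (fun _ => hsa _) (fun _ => hidem _) (fun _ => hsum _) (fun _ => hQP _)
  refine ⟨fun l => M (l ∘ e.symm), fun l => hM _, fun K hK hPK a x => ?_⟩
  have := hMK K hK (fun _ => hPK _) (e a) x
  rw [e.symm_apply_apply] at this
  rw [← this, ← (e.arrowCongr (Equiv.refl X)).sum_comp]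
  refine Finset.sum_congr rfl fun l _ => ?_
  have hl : e.arrowCongr (Equiv.refl X) l = l ∘ e.symm := rfl
  simp [hl]

end

/-! ### Local hidden variables -/

section
variable {A B X Y : Type*} [Fintype A] [Fintype X] [Fintype Y]

open Classical in
/-- A correlation is classical if for every `b` there is a joint distribution `W · b ·` of a
function `l : A → X` and an output of Bob such that the distribution of `l` does not depend on `b`, and
that has `p.prob a b` as the distribution of `l a` and Bob's output. -/
theorem Correlation.isClassical_of_deterministic [Nonempty A] [Nonempty B]
    (p : Correlation A B X Y) (W : (A → X) → B → Y → ℝ) (hW : ∀ l b y, 0 ≤ W l b y)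
    (hmarg : ∀ l b b', ∑ y, W l b y = ∑ y, W l b' y)
    (hp : ∀ a b x y, (∑ l, if l a = x then W l b y else 0) = p.prob a b x y) :
    p.IsClassical := by
  obtain ⟨a₀⟩ := ‹Nonempty A›
  obtain ⟨b₀⟩ := ‹Nonempty B›
  set w : (A → X) → ℝ := fun l => ∑ y, W l b₀ y with hw
  have hw0 : ∀ l, 0 ≤ w l := fun l => Finset.sum_nonneg fun y _ => hW l b₀ y
  have hw1 : ∑ l, w l = 1 := by
    rw [← p.sum_eq_one a₀ b₀]
    calc ∑ l, w l = ∑ l : A → X, ∑ y, ∑ x, if l a₀ = x then W l b₀ y else 0 := by simp [hw]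
      _ = ∑ x, ∑ y, p.prob a₀ b₀ x y := by
        rw [Finset.sum_comm_cycle]
        simp_rw [← hp]
        exact Finset.sum_congr rfl fun x _ => Finset.sum_comm
  -- Bob's output distribution given `l`. Where `l` has probability zero any distribution will do;
  -- his marginal is one.
  let r : (A → X) → B → Y → ℝ := fun l b y =>
    if w l = 0 then ∑ x, p.prob a₀ b x y else W l b y / w l
  have hwr : ∀ l b y, w l * r l b y = W l b y := fun l b y => by
    by_cases h : w l = 0
    · have h' : ∑ y, W l b y = 0 := (hmarg l b b₀).trans h
      rw [h, zero_mul, (Finset.sum_eq_zero_iff_of_nonneg fun y _ => hW l b y).mp h' y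
        (Finset.mem_univ y)]
    · simp only [r, if_neg h]
      field_simp
  have heq : p.prob = ∑ l, w l • fun a b x y => (if l a = x then (1 : ℝ) else 0) * r l b y := by
    ext a b x y
    simp only [Finset.sum_apply, Pi.smul_apply, smul_eq_mul, ← hp a b x y]
    refine Finset.sum_congr rfl fun l _ => ?_
    rw [mul_left_comm, hwr]
    simp
  rw [Correlation.IsClassical, heq]
  refine (convex_convexHull ℝ _).sum_mem (fun l _ => hw0 l) hw1 fun l _ =>
    subset_convexHull ℝ _ ⟨fun a x => if l a = x then 1 else 0, r l, ?_, ?_, ?_, ?_, ?_⟩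
  · intro a x; dsimp only; split_ifs <;> simp
  · intro a; simp
  · intro b y
    simp only [r]
    split_ifs
    · exact Finset.sum_nonneg fun x _ => p.nonneg _ _ _ _
    · exact div_nonneg (hW _ _ _) (hw0 l)
  · intro b
    simp only [r]
    split_ifs with h
    · rw [Finset.sum_comm]; exact p.sum_eq_one a₀ b
    · rw [← Finset.sum_div, hmarg l b b₀]; exact div_self h
  · intros; rfl

end

/-! ### From orthogonal ensembles to hidden variables -/

section
variable {V : Type*} [NormedAddCommGroup V] [InnerProductSpace ℂ V] [FiniteDimensional ℂ V]
variable {A B X Y : Type*} [Fintype X] [Fintype Y]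

/-- Suppose that, for each `a`, the positive operators `σ a x` are mutually orthogonal with sum `s`.
Then the projections `P a x = σ a x * s⁻¹` (with the pseudo-inverse of `s`) onto their supports add
up to the projection `Q = s * s⁻¹` onto the support of `s`, for every `a`. -/
theorem exists_supportProjections {s : V →ₗ[ℂ] V} (hs : s.IsPositive) (σ : A → X → V →ₗ[ℂ] V)
    (hpos : ∀ a x, (σ a x).IsPositive) (hsum : ∀ a, ∑ x, σ a x = s)
    (horth : ∀ a x x', x ≠ x' → σ a x * σ a x' = 0) :
    ∃ (Q : V →ₗ[ℂ] V) (P : A → X → V →ₗ[ℂ] V),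
      Q.IsPositive ∧ Q * opSqrt s = opSqrt s ∧ (∀ a, ∑ x, P a x = Q) ∧
      ∀ a x, IsSelfAdjoint (P a x) ∧ P a x * P a x = P a x ∧ Q * P a x = P a x ∧
        P a x * s = σ a x ∧ Commute s (P a x) ∧
        ∀ S x', σ a x * S * σ a x' = 0 → P a x * S * P a x' = 0 := by
  obtain ⟨J, hJ, hsJs, hJsJ, hJcomm⟩ := exists_pseudoInverse hs
  have hσl : ∀ a x, s * σ a x = σ a x * σ a x := fun a x => by
    rw [← hsum a, Finset.sum_mul, Finset.sum_eq_single x (fun z _ hz => horth a z x hz) (by simp)]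
  have hσr : ∀ a x, σ a x * s = σ a x * σ a x := fun a x => by
    rw [← hsum a, Finset.mul_sum,
      Finset.sum_eq_single x (fun z _ hz => horth a x z hz.symm) (by simp)]
  have hsσ : ∀ a x, Commute s (σ a x) := fun a x => (hσl a x).trans (hσr a x).symm
  have hJσ : ∀ a x, Commute J (σ a x) := fun a x => hJcomm _ (hsσ a x)
  have hsJ : Commute s J := (hJcomm s (Commute.refl s)).symm
  have hss := hs.isSelfAdjoint
  have hQ : IsSelfAdjoint (s * J) := hss.commute_iff hJ |>.mp hsJ
  have hσQ : ∀ a x, σ a x * (s * J) = σ a x := fun a x => by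
    have h : σ a x * (s * J - 1) = 0 := by
      apply mul_eq_zero_of_star_mul_self_mul
      rw [(hpos a x).isSelfAdjoint.star_eq, ← hσr, mul_sub, mul_one, mul_assoc, hsJ.eq,
        ← mul_assoc s, hsJs, sub_self]
    rwa [mul_sub, mul_one, sub_eq_zero] at h
  have hPeq : ∀ a x, J * σ a x = σ a x * J := fun a x => (hJσ a x).eq
  refine ⟨s * J, fun a x => σ a x * J, ?_, ?_, fun a => ?_, fun a x => ⟨?_, ?_, ?_, ?_, ?_, ?_⟩⟩
  · have := isPositive_conj_self LinearMap.isPositive_one hQ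
    rwa [mul_one, mul_assoc, ← mul_assoc J, hJsJ] at this
  · have h : opSqrt s * (s * J - 1) = 0 := by
      apply mul_eq_zero_of_star_mul_self_mul
      rw [(opSqrt_isPositive s).isSelfAdjoint.star_eq, opSqrt_mul_self hs, mul_sub, mul_one, hsJ.eq,
        ← mul_assoc, hsJs, sub_self]
    have h' := congr(star $h)
    rwa [star_mul, star_sub, hQ.star_eq, (opSqrt_isPositive s).isSelfAdjoint.star_eq, star_one,
      star_zero, sub_mul, one_mul, sub_eq_zero] at h'
  · rw [← Finset.sum_mul, hsum]
  · exact (hpos a x).isSelfAdjoint.commute_iff hJ |>.mp (hJσ a x).symm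
  · calc σ a x * J * (σ a x * J) = σ a x * σ a x * (J * J) := by
          rw [mul_assoc, ← mul_assoc J, hPeq]; simp only [mul_assoc]
      _ = σ a x * (s * J) * J := by rw [← hσr]; simp only [mul_assoc]
      _ = σ a x * J := by rw [hσQ]
  · calc s * J * (σ a x * J) = σ a x * (s * J) * J := by
          rw [mul_assoc, ← mul_assoc J, hPeq, mul_assoc, ← mul_assoc s, (hsσ a x).eq]
          simp only [mul_assoc]
      _ = σ a x * J := by rw [hσQ]
  · rw [mul_assoc, ← hsJ.eq, hσQ]
  · exact (hsσ a x).mul_right hsJ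
  · intro S x' h
    change σ a x * J * S * (σ a x' * J) = 0
    rw [← hPeq a x]
    calc J * σ a x * S * (σ a x' * J) = J * (σ a x * S * σ a x') * J := by
          simp only [mul_assoc]
      _ = 0 := by rw [h]; simp

open Classical in
/-- If the operators `σ a x` decompose `s` orthogonally for each `a`, and `S b y` is block diagonal
with respect to each of these decompositions, then the numbers `Tr[σ a x * S b y]` are the
marginals of joint distributions `W · b ·` on `(A → X) × Y`, with first marginal independent of
`b`. -/
theorem exists_hiddenVariable [Fintype A] {s : V →ₗ[ℂ] V} (hs : s.IsPositive)
    (σ : A → X → V →ₗ[ℂ] V)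
    (hpos : ∀ a x, (σ a x).IsPositive) (hsum : ∀ a, ∑ x, σ a x = s)
    (S : B → Y → V →ₗ[ℂ] V) (hS : ∀ b, IsPOVM (S b))
    (horth : ∀ a b y x x', x ≠ x' → σ a x * S b y * σ a x' = 0)
    (horth' : ∀ a x x', x ≠ x' → σ a x * σ a x' = 0) :
    ∃ W : (A → X) → B → Y → ℝ, (∀ l b y, 0 ≤ W l b y) ∧
      (∀ l b b', ∑ y, W l b y = ∑ y, W l b' y) ∧
      ∀ a b x y, ((∑ l, if l a = x then W l b y else 0 : ℝ) : ℂ) =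
        LinearMap.trace ℂ V (σ a x * S b y) := by
  obtain ⟨Q, P, hQ, hQs, hPsum, hP⟩ := exists_supportProjections hs σ hpos hsum horth'
  choose hsa hidem hQP hPs hsP hPSP using hP
  obtain ⟨M, hM, hMK⟩ := exists_sequential_measurement P Q hQ hsa hidem hPsum hQP
  have hr := (opSqrt_isPositive s).isSelfAdjoint
  have hsQ : opSqrt s * Q = opSqrt s := by
    have := congr(star $hQs)
    rwa [star_mul, hr.star_eq, hQ.isSelfAdjoint.star_eq] at this
  let K : B → Y → V →ₗ[ℂ] V := fun b y => opSqrt s * S b y * opSqrt s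
  have hK : ∀ b y, (K b y).IsPositive := fun b y => isPositive_conj_self ((hS b).1 y) hr
  have hKsum : ∀ b, ∑ y, K b y = s := fun b => by
    rw [← Finset.sum_mul, ← Finset.mul_sum, (hS b).2, ← Module.End.one_eq_id, mul_one,
      opSqrt_mul_self hs]
  have hrP : ∀ a x, opSqrt s * P a x = P a x * opSqrt s := fun a x =>
    (commute_opSqrt (hsP a x)).eq
  -- Both sides are equal to `P a x * S b y * P a x`.
  have hPSQ : ∀ a b x y, P a x * S b y * Q = Q * S b y * P a x := fun a b x y => by
    conv_lhs => rw [← hPsum a, Finset.mul_sum, Finset.sum_eq_single x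
      (fun z _ hz => hPSP a x _ _ (horth a b y x z hz.symm)) (by simp)]
    conv_rhs => rw [← hPsum a, Finset.sum_mul, Finset.sum_mul, Finset.sum_eq_single x
      (fun z _ hz => hPSP a z _ _ (horth a b y z x hz)) (by simp)]
  have hPK : ∀ a b x y, Commute (P a x) (K b y) := fun a b x y => by
    calc P a x * (opSqrt s * S b y * opSqrt s)
        = opSqrt s * (P a x * S b y * Q) * opSqrt s := by
          rw [← mul_assoc, ← mul_assoc, ← hrP]
          simp only [mul_assoc, hQs]
      _ = opSqrt s * S b y * opSqrt s * P a x := by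
          rw [hPSQ, ← mul_assoc, ← mul_assoc, hsQ, mul_assoc, ← hrP, mul_assoc, mul_assoc,
            mul_assoc]
  have hQK : ∀ b y, Q * K b y = K b y := fun b y => by
    simp only [K, ← mul_assoc, hQs]
  have hre : ∀ l b y, (((LinearMap.trace ℂ V (M l * K b y)).re : ℝ) : ℂ) =
      LinearMap.trace ℂ V (M l * K b y) := fun l b y =>
    (Complex.eq_re_of_ofReal_le (trace_mul_nonneg (hM l) (hK b y))).symm
  refine ⟨fun l b y => (LinearMap.trace ℂ V (M l * K b y)).re, fun l b y => ?_,
    fun l b b' => ?_, fun a b x y => ?_⟩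
  · exact (Complex.nonneg_iff.mp (trace_mul_nonneg (hM l) (hK b y))).1
  · simp only [← Complex.re_sum, ← map_sum, ← Finset.mul_sum, hKsum]
  · push_cast
    simp only [apply_ite, Complex.ofReal_zero, hre]
    rw [hMK _ (hQK b y) (fun a x => hPK a b x y), ← hPs]
    simp only [K, ← mul_assoc]
    rw [LinearMap.trace_mul_comm, ← mul_assoc, ← mul_assoc, hrP, mul_assoc (P a x),
      opSqrt_mul_self hs]

end

/-! ### Strategies that allow perfect guessing -/

section
open TensorProduct (map)
variable {A B X Y : Type*} [Fintype X] [Fintype Y]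
  {D E : Type*} [NormedAddCommGroup D] [InnerProductSpace ℂ D] [FiniteDimensional ℂ D]
  [NormedAddCommGroup E] [InnerProductSpace ℂ E] [FiniteDimensional ℂ E]

/-- The unnormalized state `σ_a^x = Tr_D[γ (R_a^x ⊗ 1)]` of Bob's system, before his own
measurement, when Alice obtains `x` on input `a`. -/
noncomputable def Strategy.steeredState (Γ : Strategy A B X Y D E) (a : A) (x : X) : E →ₗ[ℂ] E :=
  partialTrace D E (Γ.γ * map (Γ.R a x) 1)

lemma Strategy.steeredState_eq (Γ : Strategy A B X Y D E) (a : A) (x : X) :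
    Γ.steeredState a x =
      partialTrace D E (map (opSqrt (Γ.R a x)) 1 * Γ.γ * map (opSqrt (Γ.R a x)) 1) := by
  rw [mul_assoc, partialTrace_map_one_mul_comm, mul_assoc, ← TensorProduct.map_mul, mul_one,
    opSqrt_mul_self ((Γ.R_povm a).1 x), Strategy.steeredState]

lemma Strategy.steeredState_isPositive (Γ : Strategy A B X Y D E) (a : A) (x : X) :
    (Γ.steeredState a x).IsPositive := by
  rw [Γ.steeredState_eq]
  refine partialTrace_isPositive (isPositive_conj_self Γ.γ_density.1 ?_)
  exact (map_isPositive (opSqrt_isPositive _) LinearMap.isPositive_one).isSelfAdjoint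

lemma Strategy.sum_steeredState (Γ : Strategy A B X Y D E) (a : A) :
    ∑ x, Γ.steeredState a x = partialTrace D E Γ.γ := by
  simp only [Strategy.steeredState, ← map_sum, ← Finset.mul_sum]
  have h : ∑ x, map (Γ.R a x) (1 : E →ₗ[ℂ] E) = 1 := by
    rw [← TensorProduct.map_one, Module.End.one_eq_id (M := D), ← (Γ.R_povm a).2]
    exact (map_sum ((TensorProduct.mapBilinear (.id ℂ) D E D E).flip 1) _ _).symm
  rw [h, mul_one]

lemma Strategy.trace_steeredState_mul (Γ : Strategy A B X Y D E) (a : A) (x : X)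
    (S : E →ₗ[ℂ] E) :
    LinearMap.trace ℂ E (Γ.steeredState a x * S) =
      LinearMap.trace ℂ (D ⊗[ℂ] E) (Γ.γ * map (Γ.R a x) S) := by
  rw [Strategy.steeredState, trace_partialTrace_mul, mul_assoc, ← TensorProduct.map_mul, mul_one,
    one_mul]

/-- Bob's measurement acts on the steered state: `ρ_{ab}^{xy} = √S_b^y σ_a^x √S_b^y`. -/
lemma Strategy.bobState_eq (Γ : Strategy A B X Y D E) (a : A) (b : B) (x : X) (y : Y) :
    Γ.bobState a b x y = opSqrt (Γ.S b y) * Γ.steeredState a x * opSqrt (Γ.S b y) := by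
  rw [Γ.steeredState_eq, ← partialTrace_map_mul_mul_map,
    ← opSqrt_map ((Γ.R_povm a).1 x) ((Γ.S_povm b).1 y), mul_assoc]
  rfl

theorem Strategy.AllowsPerfectGuessing.steeredState_mul_mul {Γ : Strategy A B X Y D E}
    (h : Γ.AllowsPerfectGuessing) (a : A) (b : B) (y : Y) {x x' : X} (hx : x ≠ x') :
    Γ.steeredState a x * Γ.S b y * Γ.steeredState a x' = 0 := by
  apply mul_mul_eq_zero_of_support ((Γ.S_povm b).1 y) (Γ.steeredState_isPositive a x)
    (Γ.steeredState_isPositive a x')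
  rw [← Γ.bobState_eq, ← Γ.bobState_eq]
  exact h a b y x x' hx

theorem Strategy.AllowsPerfectGuessing.steeredState_mul [Nonempty B] {Γ : Strategy A B X Y D E}
    (h : Γ.AllowsPerfectGuessing) (a : A) {x x' : X} (hx : x ≠ x') :
    Γ.steeredState a x * Γ.steeredState a x' = 0 := by
  obtain ⟨b⟩ := ‹Nonempty B›
  calc Γ.steeredState a x * Γ.steeredState a x'
      = ∑ y, Γ.steeredState a x * Γ.S b y * Γ.steeredState a x' := by
        rw [← Finset.sum_mul, ← Finset.mul_sum, (Γ.S_povm b).2, ← Module.End.one_eq_id, mul_one]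
    _ = 0 := Finset.sum_eq_zero fun y _ => h.steeredState_mul_mul a b y hx

/-- `Tr[γ (R_a^x ⊗ S_b^y)] = Tr[σ_a^x S_b^y]` is real, and these numbers form a correlation. -/
theorem Strategy.exists_achieves [Fintype A] [Fintype B] (Γ : Strategy A B X Y D E) :
    ∃ p : Correlation A B X Y, Γ.Achieves p := by
  let t : A → B → X → Y → ℂ := fun a b x y => LinearMap.trace ℂ E (Γ.steeredState a x * Γ.S b y)
  have ht : ∀ a b x y, 0 ≤ t a b x y := fun a b x y =>
    trace_mul_nonneg (Γ.steeredState_isPositive a x) ((Γ.S_povm b).1 y)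
  have hy : ∀ a b x, ∑ y, t a b x y = LinearMap.trace ℂ E (Γ.steeredState a x) := fun a b x => by
    rw [← map_sum, ← Finset.mul_sum, (Γ.S_povm b).2, ← Module.End.one_eq_id, mul_one]
  have hx : ∀ a b y, ∑ x, t a b x y = LinearMap.trace ℂ E (partialTrace D E Γ.γ * Γ.S b y) :=
    fun a b y => by rw [← map_sum, ← Finset.sum_mul, Γ.sum_steeredState]
  have h1 : LinearMap.trace ℂ E (partialTrace D E Γ.γ) = 1 := by
    have := trace_partialTrace_mul 1 Γ.γ
    rwa [TensorProduct.map_one, mul_one, mul_one, Γ.γ_density.2] at this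
  refine ⟨⟨fun a b x y => (t a b x y).re, fun a b x y => ?_, fun a b => ?_,
    fun a x b b' => ?_, fun b y a a' => ?_⟩, fun a b x y => ?_⟩
  · exact (Complex.nonneg_iff.mp (ht a b x y)).1
  · simp only [← Complex.re_sum, hy]
    rw [← map_sum, Γ.sum_steeredState, h1, Complex.one_re]
  · simp only [← Complex.re_sum, hy]
  · simp only [← Complex.re_sum, hx]
  · exact (Complex.eq_re_of_ofReal_le (ht a b x y)).symm.trans (Γ.trace_steeredState_mul a x _)

end
end NonlocalGame

theorem corollary6 {A B X Y : Type*} [Fintype A] [Fintype B] [Fintype X] [Fintype Y]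
    {D E : Type*} [NormedAddCommGroup D] [InnerProductSpace ℂ D] [FiniteDimensional ℂ D]
    [NormedAddCommGroup E] [InnerProductSpace ℂ E] [FiniteDimensional ℂ E]
    (G : NonlocalGame.Game A B X Y) (hG : G.CompleteSupport)
    (Γ : NonlocalGame.Strategy A B X Y D E) (hΓ : Γ.AllowsPerfectGuessing) :
    (∃ p : NonlocalGame.Correlation A B X Y, Γ.Achieves p) ∧
      ∀ p : NonlocalGame.Correlation A B X Y, Γ.Achieves p → p.IsClassical := by
  refine ⟨Γ.exists_achieves, fun p hp => ?_⟩
  -- The distribution on input pairs has total mass one, so there are inputs.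
  have hA : Nonempty A := by
    by_contra h
    rw [not_nonempty_iff] at h
    simpa using G.q_sum
  have hB : Nonempty B := by
    by_contra h
    rw [not_nonempty_iff] at h
    simpa using G.q_sum
  obtain ⟨W, hW, hmarg, hWp⟩ := NonlocalGame.exists_hiddenVariable
    (NonlocalGame.partialTrace_isPositive Γ.γ_density.1) Γ.steeredState
    Γ.steeredState_isPositive Γ.sum_steeredState Γ.S Γ.S_povm
    (fun a b y _ _ => hΓ.steeredState_mul_mul a b y) (fun a _ _ => hΓ.steeredState_mul a)
  refine p.isClassical_of_deterministic W hW hmarg fun a b x y => ?_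
  have h := (hWp a b x y).trans ((Γ.trace_steeredState_mul a x _).trans (hp a b x y).symm)
  exact_mod_cast h
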